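/- All graphs are finite; loops and parallel edges are allowed. For a graph $G$ let $\Delta G=|E(G)|-|V(G)|$, for $X\subseteq E(G)$ let $G\langle X\rangle$ be the subgraph formed by the edges in $X$ and their ends, and for a vertex $x$ let $S(x,G)$ be the set of edges incident to $x$ and $s(x,G)=|S(x,G)|$. A leaf is a vertex of degree one (a loop adds two to the degree). A graph is a cacti-graph if it has no isolated vertices, no leaves, and no component that is a cycle (a loop at a vertex and a pair of parallel edges form cycles); a cactus is a connected cacti-graph. For $k\ge 1$ the $k$-circular matroid $M_k(G)$ is the matroid on $E(G)$ whose circuits are the sets $C\subseteq E(G)$ such that $\Delta (G\langle C\rangle)=k$ and $G\langle C\rangle$ is a cacti-graph; $\rho^*_k(G)$ is its corank, i.e. the rank of the dual matroid. A matroid is connected if its ground set is non-empty, it has no loops and no coloops, and every two of its elements belong to a common circuit. A cocircuit $K$ of a connected matroid $M$ is non-separating if $M\setminus K$ is connected. **Theorem.** Let $G$ be a finite graph without isolated vertices and let $k\ge 1$. Suppose that $M_k(G)$ is a connected matroid, and let $K$ be a set of edges. Then the following are equivalent: (c1) $K$ is a non-separating cocircuit of $M_k(G)$; (c2) there is a vertex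 $x\in V(G)$ such that $K=S(x,G)$, $s(x,G)\le\rho^*_k(G)$, and $G\setminus x$ is a cactus if $k=1$, and a cacti-graph if $k\ge 2$. -/

import Mathlib

open scoped Matroid

namespace Graph

variable {α β : Type*}

/-- `Δ G = |E(G)| - |V(G)|` (for a finite graph `G`). -/
noncomputable def excess (G : Graph α β) : ℤ := (G.edgeSet.ncard : ℤ) - (G.vertexSet.ncard : ℤ)

/-- The degree of a vertex of a finite graph; a loop counts twice. -/
noncomputable def degree (G : Graph α β) (v : α) : ℕ :=
  (G.incidenceSet v).ncard + (G.loopSet v).ncard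

/-- An isolated vertex: no edge is incident to it. -/
def IsIsolated (G : Graph α β) (v : α) : Prop := v ∈ G.vertexSet ∧ G.incidenceSet v = ∅

/-- A leaf: a vertex of degree one. -/
def IsLeaf (G : Graph α β) (v : α) : Prop := v ∈ G.vertexSet ∧ G.degree v = 1

/-- The graph is non-empty and any two vertices are joined by a walk. -/
def IsConnected (G : Graph α β) : Prop :=
  G.vertexSet.Nonempty ∧
    ∀ x ∈ G.vertexSet, ∀ y ∈ G.vertexSet, Relation.ReflTransGen G.Adj x y

/-- The connected component of `G` that contains the vertex `v`. -/
def component (G : Graph α β) (v : α) : Graph α β :=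
  G.induce {w | w ∈ G.vertexSet ∧ Relation.ReflTransGen G.Adj v w}

/-- A (finite) graph is a cycle if it is connected and 2-regular. A vertex with one loop and a
pair of vertices joined by two parallel edges are cycles. -/
def IsCycle (G : Graph α β) : Prop := G.IsConnected ∧ ∀ v ∈ G.vertexSet, G.degree v = 2

/-- A cacti-graph: no isolated vertices, no leaves, no components that are cycles. -/
structure IsCactiGraph (G : Graph α β) : Prop where
  not_isolated : ∀ v, ¬ G.IsIsolated v
  not_leaf : ∀ v, ¬ G.IsLeaf v
  not_cycle : ∀ v ∈ G.vertexSet, ¬ (G.component v).IsCycle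

/-- A cactus: a connected cacti-graph. -/
def IsCactus (G : Graph α β) : Prop := G.IsCactiGraph ∧ G.IsConnected

/-- The set of ends of the edges in `X`. -/
def endSet (G : Graph α β) (X : Set β) : Set α := {v | ∃ e ∈ X, G.Inc e v}

/-- The subgraph `G⟨X⟩` induced by a set `X` of edges: its edges are those in `X`, its vertices
are their ends. -/
def edgeInduce (G : Graph α β) (X : Set β) : Graph α β := (G.restrict X).induce (G.endSet X)

/-- The collection `𝒞_k(G)` of edge sets `C` such that `Δ(G⟨C⟩) = k` and `G⟨C⟩` is a
cacti-graph. -/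
def kCircuits (G : Graph α β) (k : ℕ) : Set (Set β) :=
  {C | C ⊆ G.edgeSet ∧ (G.edgeInduce C).excess = k ∧ (G.edgeInduce C).IsCactiGraph}

section aux

variable {G : Graph α β} {X Y C : Set β} {k : ℕ}

lemma edgeInduce_isLink {e : β} {x y : α} :
    (G.edgeInduce X).IsLink e x y ↔ e ∈ X ∧ G.IsLink e x y := by
  simp only [edgeInduce, induce_isLink, restrict_isLink, endSet, Set.mem_ofPred_eq]
  exact ⟨fun h => h.1, fun h => ⟨h, ⟨e, h.1, h.2.inc_left⟩, ⟨e, h.1, h.2.inc_right⟩⟩⟩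

lemma edgeInduce_inc {e : β} {x : α} : (G.edgeInduce X).Inc e x ↔ e ∈ X ∧ G.Inc e x := by
  simp [Inc, edgeInduce_isLink]

lemma vertexSet_edgeInduce : (G.edgeInduce X).vertexSet = G.endSet X := rfl

lemma edgeSet_edgeInduce (hX : X ⊆ G.edgeSet) : (G.edgeInduce X).edgeSet = X := by
  ext e
  rw [edge_mem_iff_exists_isLink]
  simp only [edgeInduce_isLink]
  constructor
  · rintro ⟨x, y, h, -⟩
    exact h
  · intro h
    obtain ⟨x, y, hxy⟩ := exists_isLink_of_mem_edgeSet (hX h)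
    exact ⟨x, y, h, hxy⟩

lemma endSet_mono (h : X ⊆ Y) : G.endSet X ⊆ G.endSet Y :=
  fun _ ⟨e, he, hv⟩ => ⟨e, h he, hv⟩

lemma endSet_union : G.endSet (X ∪ Y) = G.endSet X ∪ G.endSet Y := by
  ext v
  simp only [endSet, Set.mem_ofPred_eq, Set.mem_union]
  grind

lemma endSet_finite (hX : X.Finite) : (G.endSet X).Finite := by
  have : G.endSet X = ⋃ e ∈ X, {v | G.Inc e v} := by
    ext v
    simp [endSet]
  rw [this]
  refine hX.biUnion fun e _ => ?_
  by_cases he : e ∈ G.edgeSet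
  · obtain ⟨x, y, h⟩ := exists_isLink_of_mem_edgeSet he
    exact (Set.toFinite {x, y}).subset fun v hv => by
      simpa using Inc.eq_or_eq_of_isLink hv h
  · simp [he]

open Classical in
/-- The number of ends (with multiplicity) of the edge `e` in `W`. -/
noncomputable def endCount (G : Graph α β) (W : Finset α) (e : β) : ℕ :=
  ∑ w ∈ W, ((if G.Inc e w then 1 else 0) + (if G.IsLoopAt e w then 1 else 0))

open Classical in
lemma endCount_eq {W : Finset α} {e : β} {x y : α} (h : G.IsLink e x y) :
    G.endCount W e = (if x ∈ W then 1 else 0) + (if y ∈ W then 1 else 0) := by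
  unfold endCount
  rw [← Finset.sum_ite_eq W x (fun _ => 1), ← Finset.sum_ite_eq W y (fun _ => 1),
    ← Finset.sum_add_distrib]
  refine Finset.sum_congr rfl fun w _ => ?_
  have h1 : G.Inc e w ↔ w = x ∨ w = y :=
    ⟨fun h' => h'.eq_or_eq_of_isLink h, by
      rintro (rfl | rfl)
      · exact h.inc_left
      · exact h.inc_right⟩
  have h2 : G.IsLoopAt e w ↔ w = x ∧ w = y := by
    rw [← isLink_self_iff, h.isLink_iff]
    grind
  rw [if_congr h1 rfl rfl, if_congr h2 rfl rfl]
  by_cases hx : w = x <;> by_cases hy : w = y <;> simp [hx, hy, eq_comm] <;> grind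

open Classical in
lemma sum_degree (hE : G.edgeSet.Finite) (W : Finset α) :
    ∑ w ∈ W, G.degree w = ∑ e ∈ hE.toFinset, G.endCount W e := by
  unfold endCount
  rw [Finset.sum_comm]
  refine Finset.sum_congr rfl fun w _ => ?_
  rw [Finset.sum_add_distrib, ← Finset.card_filter, ← Finset.card_filter, degree]
  congr 1
  · rw [← Set.ncard_coe_finset]
    congr 1
    ext e
    simp only [mem_incidenceSet, Finset.coe_filter, Set.Finite.mem_toFinset, Set.mem_ofPred_eq]
    exact ⟨fun h => ⟨h.edge_mem, h⟩, fun h => h.2⟩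
  · rw [← Set.ncard_coe_finset]
    congr 1
    ext e
    simp only [mem_loopSet, Finset.coe_filter, Set.Finite.mem_toFinset, Set.mem_ofPred_eq]
    exact ⟨fun h => ⟨h.edge_mem, h⟩, fun h => h.2⟩

lemma component_degree {v w : α} (hw : w ∈ (G.component v).vertexSet) :
    (G.component v).degree w = G.degree w := by
  have key : ∀ e y, (G.component v).IsLink e w y ↔ G.IsLink e w y := by
    intro e y
    simp only [component, induce_isLink, and_iff_left_iff_imp]
    intro h
    exact ⟨hw, h.right_mem, hw.2.tail h.adj⟩
  have h1 : (G.component v).incidenceSet w = G.incidenceSet w := by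
    ext e
    simp [Inc, key]
  have h2 : (G.component v).loopSet w = G.loopSet w := by
    ext e
    simp only [mem_loopSet, ← isLink_self_iff, key]
  rw [degree, degree, h1, h2]

/-- Every edge set `Y` with `|Y| ≥ |V(G⟨Y⟩)| + k` contains a member of `𝒞_k(G)`. -/
lemma exists_kCircuit_subset (hE : G.edgeSet.Finite) (hk : 1 ≤ k) (hY : Y ⊆ G.edgeSet)
    (h : (G.endSet Y).ncard + k ≤ Y.ncard) : ∃ C ∈ G.kCircuits k, C ⊆ Y := by
  classical
  induction hn : Y.ncard using Nat.strong_induction_on generalizing Y with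
  | _ n ih =>
  have hYf : Y.Finite := hE.subset hY
  by_cases hsm : ∃ Z ⊂ Y, (G.endSet Z).ncard + k ≤ Z.ncard
  · obtain ⟨Z, hZ, hZk⟩ := hsm
    obtain ⟨C, hC, hCZ⟩ := ih Z.ncard (hn ▸ Set.ncard_lt_ncard hZ hYf)
      (hZ.subset.trans hY) hZk rfl
    exact ⟨C, hC, hCZ.trans hZ.subset⟩
  push Not at hsm
  have hVf := G.endSet_finite hYf
  have hHE := edgeSet_edgeInduce hY
  have hrem : ∀ e ∈ Y, (Y \ {e}).ncard + 1 = Y.ncard ∧ Y \ {e} ⊂ Y := fun e he =>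
    ⟨Set.ncard_sdiff_singleton_add_one he hYf, ⟨Set.sdiff_subset, fun hs => (hs he).2 rfl⟩⟩
  refine ⟨Y, ⟨hY, ?_, ?_, ?_, ?_⟩, subset_rfl⟩
  · rw [excess, hHE, vertexSet_edgeInduce]
    have hne : Y.Nonempty := by
      rw [← Set.ncard_pos hYf]
      omega
    obtain ⟨e, he⟩ := hne
    have h1 := hrem e he
    have h2 := hsm _ h1.2
    have h3 := Set.ncard_le_ncard (endSet_mono (G := G) h1.2.subset) hVf
    omega
  · rintro v ⟨⟨e, he, hv⟩, hi⟩
    have : e ∈ (G.edgeInduce Y).incidenceSet v := edgeInduce_inc.2 ⟨he, hv⟩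
    simp [hi] at this
  · rintro v ⟨hv, hd⟩
    have hfin : ((G.edgeInduce Y).incidenceSet v).Finite :=
      hYf.subset fun e he => (edgeInduce_inc.1 he).1
    have hle := Set.ncard_le_ncard
      ((G.edgeInduce Y).loopSet_subset_incidenceSet v) hfin
    rw [degree] at hd
    have h1 : ((G.edgeInduce Y).incidenceSet v).ncard = 1 := by omega
    obtain ⟨e, he⟩ := Set.ncard_eq_one.1 h1
    have heY : e ∈ Y := by
      have : e ∈ (G.edgeInduce Y).incidenceSet v := by simp [he]
      exact (edgeInduce_inc.1 this).1
    have hsub : G.endSet (Y \ {e}) ⊆ G.endSet Y \ {v} := by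
      rintro u ⟨f, ⟨hf, hfe⟩, hu⟩
      refine ⟨⟨f, hf, hu⟩, ?_⟩
      rintro rfl
      have : f ∈ (G.edgeInduce Y).incidenceSet u := edgeInduce_inc.2 ⟨hf, hu⟩
      rw [he] at this
      exact hfe this
    have h2 := Set.ncard_le_ncard hsub (hVf.subset Set.sdiff_subset)
    have h3 := Set.ncard_sdiff_singleton_add_one (s := G.endSet Y) hv hVf
    have h4 := hrem e heY
    have h5 := hsm _ h4.2
    omega
  · rintro v hv ⟨-, hd⟩
    set H := G.edgeInduce Y with hH
    set W := (H.component v).vertexSet with hW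
    have hWV : W ⊆ G.endSet Y := fun w hw => hw.1
    have hWf : W.Finite := hVf.subset hWV
    have hvW : v ∈ W := ⟨hv, Relation.ReflTransGen.refl⟩
    have hclosed : ∀ e x y, H.IsLink e x y → x ∈ W → y ∈ W := fun e x y hl hx =>
      ⟨hl.right_mem, hx.2.tail hl.adj⟩
    set F := {e ∈ Y | ∃ w ∈ W, G.Inc e w} with hF
    have hFY : F ⊆ Y := Set.sep_subset ..
    have hFf : F.Finite := hYf.subset hFY
    have hHf : H.edgeSet.Finite := hHE ▸ hYf
    have hcount := H.sum_degree hHf hWf.toFinset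
    have hl : ∑ w ∈ hWf.toFinset, H.degree w = W.ncard * 2 := by
      rw [Set.ncard_eq_toFinset_card W hWf]
      refine Finset.sum_const_nat fun w hw => ?_
      have hw' := hWf.mem_toFinset.1 hw
      rw [← component_degree hw']
      exact hd w hw'
    have hr : ∑ e ∈ hHf.toFinset, H.endCount hWf.toFinset e = F.ncard * 2 := by
      have h1 : ∀ e ∈ hHf.toFinset, H.endCount hWf.toFinset e = if e ∈ F then 2 else 0 := by
        intro e he
        have heH : e ∈ H.edgeSet := by simpa using he
        obtain ⟨x, y, hxy⟩ := exists_isLink_of_mem_edgeSet heH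
        have hG := edgeInduce_isLink.1 hxy
        rw [endCount_eq hxy]
        simp only [Set.Finite.mem_toFinset]
        have hxy' : x ∈ W ↔ y ∈ W := ⟨hclosed e x y hxy, hclosed e y x hxy.symm⟩
        have heF : e ∈ F ↔ x ∈ W := by
          constructor
          · rintro ⟨-, w, hw, hi⟩
            rcases hi.eq_or_eq_of_isLink hG.2 with rfl | rfl
            · exact hw
            · exact hxy'.2 hw
          · exact fun hx => ⟨hG.1, x, hx, hG.2.inc_left⟩
        by_cases hx : x ∈ W <;> simp [heF, ← hxy', hx]
      rw [Finset.sum_congr rfl h1, ← Finset.sum_filter, Finset.sum_const, smul_eq_mul,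
        ← Set.ncard_coe_finset]
      congr 2
      ext e
      simp only [Finset.coe_filter, Set.Finite.mem_toFinset, Set.mem_ofPred_eq, hHE]
      exact ⟨fun h => h.2, fun h => ⟨hFY h, h⟩⟩
    have hFW : F.ncard = W.ncard := by omega
    have hWpos : 0 < W.ncard := (Set.ncard_pos hWf).2 ⟨v, hvW⟩
    have hFne : F.Nonempty := by
      rw [← Set.ncard_pos hFf]
      omega
    obtain ⟨f, hf⟩ := hFne
    have hss : Y \ F ⊂ Y := ⟨Set.sdiff_subset, fun hs => (hs (hFY hf)).2 hf⟩
    have hsub : G.endSet (Y \ F) ⊆ G.endSet Y \ W := by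
      rintro u ⟨g, ⟨hg, hgF⟩, hu⟩
      exact ⟨⟨g, hg, hu⟩, fun huW => hgF ⟨hg, u, huW, hu⟩⟩
    have h2 := Set.ncard_le_ncard hsub (hVf.subset Set.sdiff_subset)
    have h3 := Set.ncard_sdiff_add_ncard_of_subset hWV hVf
    have h4 := Set.ncard_sdiff_add_ncard_of_subset hFY hYf
    have h5 := hsm _ hss
    omega

lemma ncard_of_mem_kCircuits (hC : C ∈ G.kCircuits k) :
    C.ncard = (G.endSet C).ncard + k := by
  have h := hC.2.1
  rw [excess, edgeSet_edgeInduce hC.1, vertexSet_edgeInduce] at h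
  omega

/-- An edge set contains no member of `𝒞_k(G)` iff each of its subsets `Y` satisfies
`|Y| ≤ |V(G⟨Y⟩)| + k - 1`. -/
lemma forall_not_kCircuit_iff (hE : G.edgeSet.Finite) (hk : 1 ≤ k) (hX : X ⊆ G.edgeSet) :
    (∀ C ∈ G.kCircuits k, ¬ C ⊆ X) ↔ ∀ Y ⊆ X, Y.ncard + 1 ≤ (G.endSet Y).ncard + k := by
  constructor
  · intro h Y hY
    by_contra hc
    obtain ⟨C, hC, hCY⟩ := exists_kCircuit_subset hE hk (hY.trans hX) (by omega)
    exact h C hC (hCY.trans hY)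
  · intro h C hC hCX
    have h1 := h C hCX
    have h2 := ncard_of_mem_kCircuits hC
    omega

lemma kCircuit_augment (hE : G.edgeSet.Finite) {I J : Set β}
    (hI : I ⊆ G.edgeSet) (hJ : J ⊆ G.edgeSet)
    (hIs : ∀ Y ⊆ I, Y.ncard + 1 ≤ (G.endSet Y).ncard + k)
    (hJs : ∀ Y ⊆ J, Y.ncard + 1 ≤ (G.endSet Y).ncard + k) (hlt : I.ncard < J.ncard) :
    ∃ e ∈ J, e ∉ I ∧ ∀ Y ⊆ insert e I, Y.ncard + 1 ≤ (G.endSet Y).ncard + k := by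
  classical
  by_contra! hcon
  have hIf := hE.subset hI
  have hJf := hE.subset hJ
  have hVf : ∀ Y ⊆ I, (G.endSet Y).Finite := fun Y hY => endSet_finite (hIf.subset hY)
  -- every `e ∈ J \ I` is spanned by a tight subset of `I`
  have htight : ∀ e ∈ J \ I, ∃ T ⊆ I, T.ncard + 1 = (G.endSet T).ncard + k ∧
      G.endSet {e} ⊆ G.endSet T := by
    rintro e ⟨heJ, heI⟩
    obtain ⟨Y, hY, hlt'⟩ := hcon e heJ heI
    have hYf : Y.Finite := (hIf.insert e).subset hY
    have heY : e ∈ Y := by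
      by_contra heY
      have hYI : Y ⊆ I := fun f hf => (hY hf).resolve_left (fun h => heY (h ▸ hf))
      have := hIs Y hYI
      omega
    have hTI : Y \ {e} ⊆ I := fun f hf => (hY hf.1).resolve_left hf.2
    have h1 := hIs _ hTI
    have h2 := Set.ncard_sdiff_singleton_add_one heY hYf
    have hmono : G.endSet (Y \ {e}) ⊆ G.endSet Y := endSet_mono Set.sdiff_subset
    have h3 := Set.ncard_le_ncard hmono (endSet_finite hYf)
    refine ⟨Y \ {e}, hTI, by omega, ?_⟩
    rw [Set.eq_of_subset_of_ncard_le hmono (by omega) (endSet_finite hYf)]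
    exact endSet_mono (by simpa using heY)
  -- the union of two tight subsets is tight
  have hunion : ∀ A ⊆ I, ∀ B ⊆ I, A.ncard + 1 = (G.endSet A).ncard + k →
      B.ncard + 1 = (G.endSet B).ncard + k →
      (A ∪ B).ncard + 1 = (G.endSet (A ∪ B)).ncard + k := by
    intro A hA B hB hAt hBt
    have h1 := Set.ncard_union_add_ncard_inter A B (hIf.subset hA) (hIf.subset hB)
    have h2 := Set.ncard_union_add_ncard_inter (G.endSet A) (G.endSet B) (hVf A hA) (hVf B hB)
    have h3 := hIs (A ∩ B) (Set.inter_subset_left.trans hA)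
    have h4 := Set.ncard_le_ncard (Set.subset_inter
      (endSet_mono (G := G) (Set.inter_subset_left (s := A) (t := B)))
      (endSet_mono Set.inter_subset_right)) ((hVf A hA).subset Set.inter_subset_left)
    have h5 := hIs (A ∪ B) (Set.union_subset hA hB)
    rw [endSet_union] at h5 ⊢
    omega
  have hbig : ∀ S : Finset β, S.Nonempty → (S : Set β) ⊆ J \ I → ∃ T ⊆ I,
      T.ncard + 1 = (G.endSet T).ncard + k ∧ G.endSet (S : Set β) ⊆ G.endSet T := by
    intro S hS
    induction hS using Finset.Nonempty.cons_induction with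
    | singleton a =>
      intro h
      simpa using htight a (h (by simp))
    | cons a s ha hs ih =>
      intro h
      rw [Finset.coe_cons] at h ⊢
      obtain ⟨T₁, hT₁, ht₁, hs₁⟩ := htight a (h (by simp))
      obtain ⟨T₂, hT₂, ht₂, hs₂⟩ := ih ((Set.subset_insert _ _).trans h)
      refine ⟨T₁ ∪ T₂, Set.union_subset hT₁ hT₂, hunion _ hT₁ _ hT₂ ht₁ ht₂, ?_⟩
      rw [Set.insert_eq, endSet_union, endSet_union]
      exact Set.union_subset_union hs₁ hs₂
  have hne : (J \ I).Nonempty := by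
    rw [Set.nonempty_iff_ne_empty]
    intro h
    have := Set.ncard_le_ncard (Set.sdiff_eq_empty.1 h) hIf
    omega
  have hdf : (J \ I).Finite := hJf.subset Set.sdiff_subset
  obtain ⟨T, hT, htT, hsT⟩ := hbig hdf.toFinset (by simpa using hne) (by simp)
  rw [Set.Finite.coe_toFinset] at hsT
  -- compare `J` with `I` inside and outside `T`
  have h1 := hJs ((J \ I) ∪ (J ∩ T)) (Set.union_subset Set.sdiff_subset Set.inter_subset_left)
  have h2 : G.endSet ((J \ I) ∪ (J ∩ T)) ⊆ G.endSet T := by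
    rw [endSet_union]
    exact Set.union_subset hsT (endSet_mono Set.inter_subset_right)
  have h3 := Set.ncard_le_ncard h2 (hVf T hT)
  have h4 : J ⊆ ((J \ I) ∪ (J ∩ T)) ∪ (I \ T) := by
    intro f hf
    by_cases hfI : f ∈ I <;> by_cases hfT : f ∈ T <;> simp [hf, hfI, hfT]
  have h5 := (Set.ncard_le_ncard h4
    (((hdf.union (hJf.subset Set.inter_subset_left))).union
      (hIf.subset Set.sdiff_subset))).trans (Set.ncard_union_le _ _)
  have h6 := Set.ncard_sdiff_add_ncard_of_subset hT hIf
  omega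

/-- No member of `𝒞_k(G)` contains a smaller set that spans at least as much excess. -/
lemma sparse_of_ssubset_kCircuit (hE : G.edgeSet.Finite)
    (hC : C ∈ G.kCircuits k) (hY : Y ⊂ C) : Y.ncard < (G.endSet Y).ncard + k := by
  classical
  obtain ⟨hCE, -, hcact⟩ := id hC
  have hcard := ncard_of_mem_kCircuits hC
  have hCf := hE.subset hCE
  have hVf := G.endSet_finite hCf
  have hHE := edgeSet_edgeInduce hCE
  set H := G.edgeInduce C with hH
  have hHf : H.edgeSet.Finite := hHE ▸ hCf
  set W := G.endSet C \ G.endSet Y with hW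
  have hWf : W.Finite := hVf.subset Set.sdiff_subset
  have hWc := Set.ncard_sdiff_add_ncard_of_subset (endSet_mono (G := G) hY.subset) hVf
  rw [← hW] at hWc
  have hFc := Set.ncard_sdiff_add_ncard_of_subset hY.subset hCf
  have hFf : (C \ Y).Finite := hCf.subset Set.sdiff_subset
  suffices h : W.ncard < (C \ Y).ncard by omega
  have hFpos : 0 < (C \ Y).ncard := by
    rw [Set.ncard_pos hFf]
    exact Set.nonempty_of_ssubset hY
  by_contra! hle
  have hdeg : ∀ w ∈ W, 2 ≤ H.degree w := by
    intro w hw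
    have h1 := hcact.not_leaf w
    have h2 := hcact.not_isolated w
    have hwV : w ∈ H.vertexSet := hw.1
    have hf : (H.incidenceSet w).Finite := hHf.subset (H.incidenceSet_subset_edgeSet w)
    have h3 : (H.incidenceSet w).ncard ≠ 0 := by
      rw [Ne, Set.ncard_eq_zero hf]
      exact fun h => h2 ⟨hwV, h⟩
    have h4 : H.degree w ≠ 1 := fun h => h1 ⟨hwV, h⟩
    rw [degree] at h4 ⊢
    omega
  have hcount := H.sum_degree hHf hWf.toFinset
  have hl : W.ncard * 2 ≤ ∑ w ∈ hWf.toFinset, H.degree w := by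
    rw [Set.ncard_eq_toFinset_card W hWf, ← smul_eq_mul]
    exact Finset.card_nsmul_le_sum _ _ _ fun w hw => hdeg w (by simpa using hw)
  have hec : ∀ e ∈ hHf.toFinset, H.endCount hWf.toFinset e ≤ if e ∈ C \ Y then 2 else 0 := by
    intro e he
    obtain ⟨x, y, hxy⟩ := exists_isLink_of_mem_edgeSet (by simpa using he : e ∈ H.edgeSet)
    have hG := edgeInduce_isLink.1 hxy
    rw [endCount_eq hxy]
    simp only [Set.Finite.mem_toFinset]
    by_cases heY : e ∈ Y
    · have hx : x ∉ W := fun h => h.2 ⟨e, heY, hG.2.inc_left⟩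
      have hy : y ∉ W := fun h => h.2 ⟨e, heY, hG.2.inc_right⟩
      simp [hx, hy]
    · rw [if_pos (show e ∈ C \ Y from ⟨hG.1, heY⟩)]
      split_ifs <;> omega
  have hr : ∑ e ∈ hHf.toFinset, (if e ∈ C \ Y then 2 else 0) = (C \ Y).ncard * 2 := by
    rw [← Finset.sum_filter, Finset.sum_const, smul_eq_mul, ← Set.ncard_coe_finset]
    congr 2
    ext e
    simp only [Finset.coe_filter, Set.Finite.mem_toFinset, Set.mem_ofPred_eq, hHE]
    exact ⟨fun h => h.2, fun h => ⟨h.1, h⟩⟩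
  have hle2 := Finset.sum_le_sum hec
  -- equality holds everywhere
  have heq : ∀ e ∈ hHf.toFinset, H.endCount hWf.toFinset e = if e ∈ C \ Y then 2 else 0 :=
    (Finset.sum_eq_sum_iff_of_le hec).1 (by omega)
  have hdeq : ∀ w ∈ hWf.toFinset, 2 = H.degree w := by
    refine (Finset.sum_eq_sum_iff_of_le fun w hw => hdeg w (by simpa using hw)).1 ?_
    rw [Finset.sum_const, smul_eq_mul, ← Set.ncard_eq_toFinset_card W hWf]
    omega
  have hclosed : ∀ e x y, H.IsLink e x y → x ∈ W → y ∈ W := by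
    intro e x y hxy hx
    have h1 := heq e (by simpa using hxy.edge_mem)
    rw [endCount_eq hxy] at h1
    simp only [Set.Finite.mem_toFinset] at h1
    by_contra hy
    rw [if_pos hx, if_neg hy] at h1
    split_ifs at h1 <;> omega
  have hWne : W.Nonempty := by
    rw [← Set.ncard_pos hWf]
    omega
  obtain ⟨v, hv⟩ := hWne
  have hreach : ∀ w, Relation.ReflTransGen H.Adj v w → w ∈ W := by
    intro w hw
    induction hw with
    | refl => exact hv
    | tail _ h ih =>
      obtain ⟨e, he⟩ := h
      exact hclosed e _ _ he ih
  have hvH : v ∈ H.vertexSet := hv.1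
  refine hcact.not_cycle v hvH ⟨⟨⟨v, hvH, Relation.ReflTransGen.refl⟩, ?_⟩, ?_⟩
  · have hfrom : ∀ w, Relation.ReflTransGen H.Adj v w →
        Relation.ReflTransGen (H.component v).Adj v w := by
      intro w hw
      induction hw with
      | refl => exact Relation.ReflTransGen.refl
      | tail hb h ih =>
        obtain ⟨e, he⟩ := h
        refine ih.tail ⟨e, ?_⟩
        simp only [component, induce_isLink]
        exact ⟨he, ⟨he.left_mem, hb⟩, ⟨he.right_mem, hb.tail he.adj⟩⟩
    intro x hx y hy
    exact (Std.Symm.symm (r := Relation.ReflTransGen (H.component v).Adj) _ _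
      (hfrom x hx.2)).trans (hfrom y hy.2)
  · intro w hw
    rw [component_degree hw]
    exact (hdeq w (by simpa using hreach w hw.2)).symm

end aux

/-- The `k`-circular matroid `M_k(G)` of a graph `G` with finitely many edges, for `k ≥ 1`:
the matroid on `E(G)` whose independent sets are the edge sets that contain no member of
`𝒞_k(G)`. Its circuits are the members of `𝒞_k(G)`, see `kCircularMatroid_isCircuit_iff`. -/
def kCircularMatroid (G : Graph α β) (hE : G.edgeSet.Finite) (k : ℕ) (hk : 1 ≤ k) : Matroid β :=
  (IndepMatroid.ofFinite hE (fun I => I ⊆ G.edgeSet ∧ ∀ C ∈ G.kCircuits k, ¬ C ⊆ I)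
    (by
      refine ⟨Set.empty_subset _, fun C hC hCe => ?_⟩
      have h := ncard_of_mem_kCircuits hC
      rw [Set.subset_empty_iff.1 hCe, Set.ncard_empty] at h
      omega)
    (fun I J hJ hIJ => ⟨hIJ.trans hJ.1, fun C hC hCI => hJ.2 C hC (hCI.trans hIJ)⟩)
    (by
      rintro I J ⟨hI, hI'⟩ ⟨hJ, hJ'⟩ hlt
      rw [forall_not_kCircuit_iff hE hk hI] at hI'
      rw [forall_not_kCircuit_iff hE hk hJ] at hJ'
      obtain ⟨e, heJ, heI, h⟩ := kCircuit_augment hE hI hJ hI' hJ' hlt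
      have hins : insert e I ⊆ G.edgeSet := Set.insert_subset (hJ heJ) hI
      exact ⟨e, heJ, heI, hins, (forall_not_kCircuit_iff hE hk hins).2 h⟩)
    (fun _ h => h.1)).matroid

lemma kCircularMatroid_ground (G : Graph α β) (hE : G.edgeSet.Finite) (k : ℕ) (hk : 1 ≤ k) :
    (G.kCircularMatroid hE k hk).E = G.edgeSet := rfl

lemma kCircularMatroid_indep_iff (G : Graph α β) (hE : G.edgeSet.Finite) (k : ℕ) (hk : 1 ≤ k)
    (I : Set β) : (G.kCircularMatroid hE k hk).Indep I ↔
      I ⊆ G.edgeSet ∧ ∀ C ∈ G.kCircuits k, ¬ C ⊆ I := Iff.rfl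

/-- The circuits of `M_k(G)` are exactly the members of `𝒞_k(G)`. -/
theorem kCircularMatroid_isCircuit_iff (G : Graph α β) (hE : G.edgeSet.Finite) (k : ℕ)
    (hk : 1 ≤ k) (C : Set β) :
    (G.kCircularMatroid hE k hk).IsCircuit C ↔ C ∈ G.kCircuits k := by
  rw [Matroid.isCircuit_iff_forall_ssubset, Matroid.Dep, kCircularMatroid_ground,
    kCircularMatroid_indep_iff]
  constructor
  · rintro ⟨⟨hdep, hCE⟩, hmin⟩
    push Not at hdep
    obtain ⟨D, hD, hDC⟩ := hdep hCE
    rcases hDC.eq_or_ssubset with rfl | hss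
    · exact hD
    · exact absurd subset_rfl
        (((kCircularMatroid_indep_iff G hE k hk D).1 (hmin hss)).2 D hD)
  · intro hC
    refine ⟨⟨fun h => h.2 C hC subset_rfl, hC.1⟩, fun I hI => ?_⟩
    refine (kCircularMatroid_indep_iff G hE k hk I).2 ⟨hI.subset.trans hC.1, fun D hD hDI => ?_⟩
    have h1 := sparse_of_ssubset_kCircuit hE hC (hDI.trans_ssubset hI)
    have h2 := ncard_of_mem_kCircuits hD
    omega

end Graph

namespace Matroid

variable {β : Type*}

/-- A matroid is connected if it is non-empty, has no loops and no coloops, and any two of its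
elements belong to a common circuit. -/
structure IsConnected (M : Matroid β) : Prop where
  nonempty : M.E.Nonempty
  not_isLoop : ∀ e, ¬ M.IsLoop e
  not_isColoop : ∀ e, ¬ M.IsColoop e
  exists_isCircuit : ∀ e ∈ M.E, ∀ f ∈ M.E, e ≠ f → ∃ C, M.IsCircuit C ∧ e ∈ C ∧ f ∈ C

/-- A cocircuit `K` of a (connected) matroid `M` is non-separating if `M \ K` is connected. -/
def IsNonseparatingCocircuit (M : Matroid β) (K : Set β) : Prop :=
  M.IsCocircuit K ∧ (M ＼ K).IsConnected

end Matroid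

/-! A set is independent in `M_k(G)` exactly when each of its subsets `Y` has at most `|V(Y)| + k -
1` edges; call `Y` tight if equality holds. Everything rests on computing rank by counting vertices.
If `A` spans a cacti-graph of excess at least `k`, its rank is `|V(A)| + k - 1`, and it stays so
after the removal of any one edge, because proper subsets of `A` have smaller excess
(`IsCactiGraph.ncard_of_isBasis`). So each edge of `A` lies on a circuit. Conversely, a non-empty
union of circuits spans a cacti-graph of excess at least `k`.

If such an `A` splits into two parts with no circuit meeting both, the ranks of the parts add up,
and the count leaves only `k = 1` with vertex-disjoint parts. Hence `M ＼ K` is connected iff the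
edges outside `K` span a cacti-graph of excess at least `k`, connected if `k = 1`
(`kCircularMatroid_delete_isConnected_iff`).

A cocircuit is a minimal set with nonspanning complement. If `M ＼ K` is connected, the rank formula
makes `E \ K` miss a vertex `x`; the complement of `S(x)` is already nonspanning, so `K = S(x)` by
minimality. Conversely, one edge at `x` added to a basis of `G \ x` gives a base, so `S(x)` is a
cocircuit. The condition `s(x) ≤ ρ*` says precisely that `G \ x` has excess at least `k`. -/

namespace Matroid

/-! ### Common circuits in a finite matroid. -/

variable {β : Type*} {M : Matroid β} {e f : β}

/-- Lying on a common circuit is a transitive relation. -/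
lemma exists_isCircuit_mem_mem_of_inter_nonempty [M.Finite] {C₁ C₂ : Set β}
    (hC₁ : M.IsCircuit C₁) (hC₂ : M.IsCircuit C₂) (he : e ∈ C₁) (hf : f ∈ C₂)
    (hne : (C₁ ∩ C₂).Nonempty) : ∃ C, M.IsCircuit C ∧ e ∈ C ∧ f ∈ C := by
  induction hn : (C₁ ∪ C₂).ncard using Nat.strong_induction_on generalizing C₁ C₂ with
  | _ n ih =>
  subst hn
  by_cases hf₁ : f ∈ C₁
  · exact ⟨C₁, hC₁, he, hf₁⟩
  by_cases he₂ : e ∈ C₂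
  · exact ⟨C₂, hC₂, he₂, hf⟩
  obtain ⟨a, ha₁, ha₂⟩ := hne
  have hfin : (C₁ ∪ C₂).Finite := hC₁.finite.union hC₂.finite
  obtain ⟨C₃, hs₃, hC₃, he₃⟩ := hC₁.strong_elimination hC₂ ha₁ ha₂ he he₂
  obtain ⟨C₄, hs₄, hC₄, hf₄⟩ := hC₂.strong_elimination hC₁ ha₂ ha₁ hf hf₁
  have hn₃ : ¬ C₃ ⊆ C₁ := fun h => (hs₃ (hC₃.eq_of_subset_isCircuit hC₁ h ▸ ha₁)).2 rfl
  have hn₄ : ¬ C₄ ⊆ C₂ := fun h => (hs₄ (hC₄.eq_of_subset_isCircuit hC₂ h ▸ ha₂)).2 rfl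
  obtain ⟨b, hb₃, hb₁⟩ := Set.not_subset.1 hn₃
  obtain ⟨c, hc₄, hc₂⟩ := Set.not_subset.1 hn₄
  have hb₂ : b ∈ C₂ := (hs₃ hb₃).1.resolve_left hb₁
  have hc₁ : c ∈ C₁ := (hs₄ hc₄).1.resolve_left hc₂
  have h14 : C₁ ∪ C₄ ⊆ C₁ ∪ C₂ := fun x hx => by have := @hs₄ x; grind
  have h32 : C₃ ∪ C₂ ⊆ C₁ ∪ C₂ := fun x hx => by have := @hs₃ x; grind
  have h34 : C₃ ∪ C₄ ⊆ (C₁ ∪ C₂) \ {a} := fun x hx => by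
    have := @hs₃ x; have := @hs₄ x; grind
  -- Either `C₁, C₄` is a pair with smaller union, or `C₄` contains all of `C₂ \ C₁`, in particular
  -- `b`. In the latter case `C₃, C₄` meet in `b`, and their union is smaller since it avoids `a`.
  by_cases hl14 : (C₁ ∪ C₄).ncard < (C₁ ∪ C₂).ncard
  · exact ih _ hl14 hC₁ hC₄ he hf₄ ⟨c, hc₁, hc₄⟩ rfl
  have heq := Set.eq_of_subset_of_ncard_le h14 (not_lt.1 hl14) hfin
  have hb₄ : b ∈ C₄ := (heq.ge (Or.inr hb₂)).resolve_left hb₁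
  refine ih _ ?_ hC₃ hC₄ he₃ hf₄ ⟨b, hb₃, hb₄⟩ rfl
  exact Set.ncard_lt_ncard (h34.trans_ssubset
    ⟨Set.sdiff_subset, fun h => (h (Or.inl ha₁)).2 rfl⟩) hfin

end Matroid

/-! ### Tight sets and the rank of a cacti-graph. -/

namespace Graph

variable {α β : Type*} {G : Graph α β} {A B I X Y C K : Set β} {k : ℕ} {hE : G.edgeSet.Finite}
  {hk : 1 ≤ k} {e f : β}

instance : (G.kCircularMatroid hE k hk).Finite := ⟨hE⟩

lemma kCircularMatroid_indep_iff_ncard : (G.kCircularMatroid hE k hk).Indep I ↔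
    I ⊆ G.edgeSet ∧ ∀ Y ⊆ I, Y.ncard + 1 ≤ (G.endSet Y).ncard + k := by
  rw [kCircularMatroid_indep_iff]
  exact and_congr_right fun h => forall_not_kCircuit_iff hE hk h

lemma ncard_add_one_le_of_indep (hI : (G.kCircularMatroid hE k hk).Indep I) :
    I.ncard + 1 ≤ (G.endSet I).ncard + k :=
  (kCircularMatroid_indep_iff_ncard.1 hI).2 I subset_rfl

lemma ncard_endSet_mono (hE : G.edgeSet.Finite) (hY : Y ⊆ G.edgeSet) (h : X ⊆ Y) :
    (G.endSet X).ncard ≤ (G.endSet Y).ncard :=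
  Set.ncard_le_ncard (endSet_mono h) (endSet_finite (hE.subset hY))

/-- The union of two tight subsets of an independent set is tight. -/
lemma ncard_union_of_tight (hI : (G.kCircularMatroid hE k hk).Indep I) (hA : A ⊆ I) (hB : B ⊆ I)
    (hAt : A.ncard + 1 = (G.endSet A).ncard + k) (hBt : B.ncard + 1 = (G.endSet B).ncard + k) :
    (A ∪ B).ncard + 1 = (G.endSet (A ∪ B)).ncard + k := by
  have hIE := kCircularMatroid_indep_iff_ncard.1 hI
  have hIf := hE.subset hIE.1
  have hVf : ∀ Y ⊆ I, (G.endSet Y).Finite := fun Y hY => endSet_finite (hIf.subset hY)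
  have h1 := Set.ncard_union_add_ncard_inter A B (hIf.subset hA) (hIf.subset hB)
  have h2 := Set.ncard_union_add_ncard_inter (G.endSet A) (G.endSet B) (hVf A hA) (hVf B hB)
  -- The bound also covers an empty intersection, since `k ≥ 1`; disjoint tight sets need no
  -- separate case.
  have h3 := hIE.2 (A ∩ B) (Set.inter_subset_left.trans hA)
  have h4 := Set.ncard_le_ncard (Set.subset_inter
    (endSet_mono (G := G) (Set.inter_subset_left (s := A) (t := B)))
    (endSet_mono Set.inter_subset_right)) ((hVf A hA).subset Set.inter_subset_left)
  have h5 := hIE.2 (A ∪ B) (Set.union_subset hA hB)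
  rw [endSet_union] at h5 ⊢
  omega

/-- The elements outside a basis are spanned by a tight subset of the basis. -/
lemma exists_tight_of_isBasis (hI : (G.kCircularMatroid hE k hk).IsBasis I A)
    (hne : (A \ I).Nonempty) : ∃ T ⊆ I, T.ncard + 1 = (G.endSet T).ncard + k ∧
      G.endSet (A \ I) ⊆ G.endSet T := by
  have htight : ∀ e ∈ A \ I, ∃ T ⊆ I, T.ncard + 1 = (G.endSet T).ncard + k ∧
      G.endSet {e} ⊆ G.endSet T := by
    rintro e ⟨heA, heI⟩
    -- The fundamental circuit minus `e` has `|V(C)| + k - 1` edges, the most its own ends allow; so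
    -- it is tight and loses no vertex of `C`.
    have hC := hI.indep.fundCircuit_isCircuit (hI.subset_closure heA) heI
    have hsub := Matroid.fundCircuit_subset_insert (G.kCircularMatroid hE k hk) e I
    have he := (G.kCircularMatroid hE k hk).mem_fundCircuit e I
    set C := (G.kCircularMatroid hE k hk).fundCircuit e I
    rw [kCircularMatroid_isCircuit_iff] at hC
    have hCf := hE.subset hC.1
    have hTI : C \ {e} ⊆ I := fun f hf => (hsub hf.1).resolve_left hf.2
    have h1 := ncard_add_one_le_of_indep (hI.indep.subset hTI)
    have h2 := Set.ncard_sdiff_singleton_add_one he hCf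
    have h3 := ncard_of_mem_kCircuits hC
    have hmono : G.endSet (C \ {e}) ⊆ G.endSet C := endSet_mono Set.sdiff_subset
    have h4 := Set.ncard_le_ncard hmono (endSet_finite hCf)
    refine ⟨C \ {e}, hTI, by omega, ?_⟩
    rw [Set.eq_of_subset_of_ncard_le hmono (by omega) (endSet_finite hCf)]
    exact endSet_mono (by simpa using he)
  have hbig : ∀ S : Finset β, S.Nonempty → (S : Set β) ⊆ A \ I → ∃ T ⊆ I,
      T.ncard + 1 = (G.endSet T).ncard + k ∧ G.endSet (S : Set β) ⊆ G.endSet T := by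
    intro S hS
    induction hS using Finset.Nonempty.cons_induction with
    | singleton a =>
      intro h
      simpa using htight a (h (by simp))
    | cons a s ha hs ih =>
      intro h
      rw [Finset.coe_cons] at h ⊢
      obtain ⟨T₁, hT₁, ht₁, hs₁⟩ := htight a (h (by simp))
      obtain ⟨T₂, hT₂, ht₂, hs₂⟩ := ih ((Set.subset_insert _ _).trans h)
      refine ⟨T₁ ∪ T₂, Set.union_subset hT₁ hT₂,
        ncard_union_of_tight hI.indep hT₁ hT₂ ht₁ ht₂, ?_⟩
      rw [Set.insert_eq, endSet_union, endSet_union]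
      exact Set.union_subset_union hs₁ hs₂
  have hdf : (A \ I).Finite := (hE.subset hI.subset_ground).subset Set.sdiff_subset
  simpa using hbig hdf.toFinset (by simpa using hne) (by simp)

lemma IsCactiGraph.two_le_degree (hE : G.edgeSet.Finite) (hA : A ⊆ G.edgeSet)
    (hcact : (G.edgeInduce A).IsCactiGraph) {v : α} (hv : v ∈ G.endSet A) :
    2 ≤ (G.edgeInduce A).degree v := by
  have h1 := hcact.not_leaf v
  have hf : ((G.edgeInduce A).incidenceSet v).Finite :=
    (hE.subset hA).subset fun e he => (edgeInduce_inc.1 he).1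
  have h3 : ((G.edgeInduce A).incidenceSet v).ncard ≠ 0 := by
    rw [Ne, Set.ncard_eq_zero hf]
    exact fun h => hcact.not_isolated v ⟨hv, h⟩
  have h4 : (G.edgeInduce A).degree v ≠ 1 := fun h => h1 ⟨hv, h⟩
  rw [degree] at h4 ⊢
  omega

/-- All degrees are at least two, while each edge contributes at most two to their sum. -/
lemma IsCactiGraph.ncard_endSet_le (hE : G.edgeSet.Finite) (hA : A ⊆ G.edgeSet)
    (hcact : (G.edgeInduce A).IsCactiGraph) : (G.endSet A).ncard ≤ A.ncard := by
  classical
  have hAf := hE.subset hA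
  have hVf := G.endSet_finite hAf
  have hHE := edgeSet_edgeInduce hA
  have hHf : (G.edgeInduce A).edgeSet.Finite := by rwa [hHE]
  have hcount := (G.edgeInduce A).sum_degree hHf hVf.toFinset
  have h1 : hVf.toFinset.card * 2 ≤ ∑ w ∈ hVf.toFinset, (G.edgeInduce A).degree w := by
    rw [← smul_eq_mul]
    exact Finset.card_nsmul_le_sum _ _ _ fun w hw => hcact.two_le_degree hE hA (by simpa using hw)
  have h2 : ∑ e ∈ hHf.toFinset, (G.edgeInduce A).endCount hVf.toFinset e ≤
      hHf.toFinset.card * 2 := by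
    rw [← smul_eq_mul]
    refine Finset.sum_le_card_nsmul _ _ _ fun e he => ?_
    obtain ⟨x, y, hxy⟩ := exists_isLink_of_mem_edgeSet (hHf.mem_toFinset.1 he)
    rw [endCount_eq hxy]
    split_ifs <;> omega
  rw [← Set.ncard_eq_toFinset_card _ hVf] at h1
  rw [← Set.ncard_eq_toFinset_card _ hHf, congrArg Set.ncard hHE] at h2
  omega

/-- A proper edge subset of a cacti-graph has smaller excess. -/
lemma IsCactiGraph.ncard_add_lt_of_ssubset (hE : G.edgeSet.Finite) (hA : A ⊆ G.edgeSet)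
    (hcact : (G.edgeInduce A).IsCactiGraph) (hY : Y ⊂ A) :
    Y.ncard + (G.endSet A).ncard < A.ncard + (G.endSet Y).ncard := by
  have hle := hcact.ncard_endSet_le hE hA
  -- `A` is itself a member of `𝒞_j(G)` with `j` its own excess, possibly `0`. The natural
  -- subtraction is exact by `hle`.
  have hmem : A ∈ G.kCircuits (A.ncard - (G.endSet A).ncard) := by
    refine ⟨hA, ?_, hcact⟩
    rw [excess, edgeSet_edgeInduce hA, vertexSet_edgeInduce]
    omega
  have := sparse_of_ssubset_kCircuit hE hmem hY
  omega

/-- If `I` is not all of `A \ {e}`, some tight `T ⊆ I` contains the ends of all the edges left over.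
Adding these edges to `T` gives a proper subset of `A` with no new vertices, and its excess, smaller
than that of `A`, bounds the number of edges left over. -/
lemma IsCactiGraph.le_ncard_of_isBasis_sdiff (hcact : (G.edgeInduce A).IsCactiGraph)
    (hA : A ⊆ G.edgeSet) (hle : (G.endSet A).ncard + k ≤ A.ncard) (he : e ∈ A)
    (hI : (G.kCircularMatroid hE k hk).IsBasis I (A \ {e})) :
    (G.endSet A).ncard + k ≤ I.ncard + 1 := by
  have hAf := hE.subset hA
  have hAe := Set.ncard_sdiff_singleton_add_one he hAf
  obtain hemp | hne := Set.eq_empty_or_nonempty ((A \ {e}) \ I)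
  · have : I = A \ {e} := hI.subset.antisymm (Set.sdiff_eq_empty.1 hemp)
    rw [this]
    omega
  obtain ⟨T, hT, ht, hs⟩ := exists_tight_of_isBasis hI hne
  have hIf := hAf.subset (hI.subset.trans Set.sdiff_subset)
  have hYA : T ∪ ((A \ {e}) \ I) ⊂ A := by
    refine ⟨Set.union_subset (hT.trans (hI.subset.trans Set.sdiff_subset))
      (Set.sdiff_subset.trans Set.sdiff_subset), fun h => ?_⟩
    rcases h he with h | h
    · exact (hI.subset (hT h)).2 rfl
    · exact h.1.2 rfl
  have h1 := hcact.ncard_add_lt_of_ssubset hE hA hYA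
  rw [endSet_union, Set.union_eq_self_of_subset_right hs, Set.ncard_union_eq
    (Set.disjoint_left.2 fun x hx hx' => hx'.2 (hT hx)) (hIf.subset hT)
    (hAf.subset (Set.sdiff_subset.trans Set.sdiff_subset))] at h1
  have h2 := Set.ncard_sdiff_add_ncard_of_subset hI.subset (hAf.subset Set.sdiff_subset)
  omega

/-- A basis of `A \ {e}` already has the largest size that the vertices of `A` permit, so adding `e`
creates a circuit. -/
lemma IsCactiGraph.exists_isCircuit_mem (hcact : (G.edgeInduce A).IsCactiGraph)
    (hA : A ⊆ G.edgeSet) (hle : (G.endSet A).ncard + k ≤ A.ncard) (he : e ∈ A) :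
    ∃ C ⊆ A, (G.kCircularMatroid hE k hk).IsCircuit C ∧ e ∈ C := by
  obtain ⟨I, hI⟩ := (G.kCircularMatroid hE k hk).exists_isBasis (A \ {e})
    (Set.sdiff_subset.trans hA)
  have h1 := hcact.le_ncard_of_isBasis_sdiff hA hle he hI
  have heI : e ∉ I := fun h => (hI.subset h).2 rfl
  have hins : insert e I ⊆ A := Set.insert_subset he (hI.subset.trans Set.sdiff_subset)
  have hdep : (G.kCircularMatroid hE k hk).Dep (insert e I) := by
    refine ⟨fun h => ?_, hins.trans hA⟩
    have h2 := ncard_add_one_le_of_indep h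
    have h3 := ncard_endSet_mono hE hA hins
    rw [Set.ncard_insert_of_notMem heI ((hE.subset hA).subset
      (hI.subset.trans Set.sdiff_subset))] at h2
    omega
  obtain ⟨C, hCs, hC⟩ := hdep.exists_isCircuit_subset
  refine ⟨C, hCs.trans hins, hC, ?_⟩
  by_contra heC
  exact hC.not_indep (hI.indep.subset fun x hx => (hCs hx).resolve_left fun h => heC (h ▸ hx))

lemma IsCactiGraph.ncard_of_isBasis (hcact : (G.edgeInduce A).IsCactiGraph)
    (hA : A ⊆ G.edgeSet) (hle : (G.endSet A).ncard + k ≤ A.ncard)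
    (hI : (G.kCircularMatroid hE k hk).IsBasis I A) :
    I.ncard + 1 = (G.endSet A).ncard + k := by
  have h1 := ncard_add_one_le_of_indep hI.indep
  have h2 := ncard_endSet_mono hE hA hI.subset
  have hAf := hE.subset hA
  obtain ⟨e, he⟩ : A.Nonempty := by
    rw [← Set.ncard_pos hAf]
    omega
  obtain ⟨J, hJ⟩ := (G.kCircularMatroid hE k hk).exists_isBasis (A \ {e})
    (Set.sdiff_subset.trans hA)
  have h3 := hcact.le_ncard_of_isBasis_sdiff hA hle he hJ
  obtain ⟨J', hJ', hJJ'⟩ := hJ.indep.subset_isBasis_of_subset (hJ.subset.trans Set.sdiff_subset)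
  have h4 := Set.ncard_le_ncard hJJ' (hAf.subset hJ'.subset)
  have h5 := hI.encard_eq_encard hJ'
  have h6 : I.ncard = J'.ncard := by rw [Set.ncard, Set.ncard, h5]
  omega

/-! ### Unions of cacti-graphs and connected restrictions. -/

lemma reflTransGen_adj_symm {x y : α} (h : Relation.ReflTransGen G.Adj x y) :
    Relation.ReflTransGen G.Adj y x :=
  Std.Symm.symm (r := Relation.ReflTransGen G.Adj) _ _ h

lemma component_isConnected {v : α} (hv : v ∈ G.vertexSet) : (G.component v).IsConnected := by
  refine ⟨⟨v, hv, Relation.ReflTransGen.refl⟩, ?_⟩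
  have hfrom : ∀ w, Relation.ReflTransGen G.Adj v w →
      Relation.ReflTransGen (G.component v).Adj v w := by
    intro w hw
    induction hw with
    | refl => exact Relation.ReflTransGen.refl
    | tail hb h ih =>
      obtain ⟨e, he⟩ := h
      refine ih.tail ⟨e, ?_⟩
      simp only [component, induce_isLink]
      exact ⟨he, ⟨he.left_mem, hb⟩, ⟨he.right_mem, hb.tail he.adj⟩⟩
  intro x hx y hy
  exact (reflTransGen_adj_symm (hfrom x hx.2)).trans (hfrom y hy.2)

lemma degree_edgeInduce_mono (hE : G.edgeSet.Finite) (hA : A ⊆ G.edgeSet) (h : C ⊆ A) (v : α) :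
    (G.edgeInduce C).degree v ≤ (G.edgeInduce A).degree v := by
  have hf : ((G.edgeInduce A).incidenceSet v).Finite :=
    (hE.subset hA).subset fun e he => (edgeInduce_inc.1 he).1
  refine Nat.add_le_add (Set.ncard_le_ncard (fun e he => ?_) hf)
    (Set.ncard_le_ncard (fun e he => ?_) (hf.subset ((G.edgeInduce A).loopSet_subset_incidenceSet v)))
  · exact edgeInduce_inc.2 ⟨h (edgeInduce_inc.1 he).1, (edgeInduce_inc.1 he).2⟩
  · rw [mem_loopSet, ← isLink_self_iff, edgeInduce_isLink] at he ⊢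
    exact ⟨h he.1, he.2⟩

/-- A union of cacti-graphs is a cacti-graph. -/
lemma isCactiGraph_of_forall_exists_subset (hE : G.edgeSet.Finite) (hA : A ⊆ G.edgeSet)
    (h : ∀ e ∈ A, ∃ C ⊆ A, e ∈ C ∧ (G.edgeInduce C).IsCactiGraph) :
    (G.edgeInduce A).IsCactiGraph := by
  refine ⟨?_, ?_, ?_⟩
  · rintro v ⟨⟨e, he, hv⟩, hi⟩
    have : e ∈ (G.edgeInduce A).incidenceSet v := edgeInduce_inc.2 ⟨he, hv⟩
    simp [hi] at this
  · rintro v ⟨⟨e, he, hv⟩, hd⟩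
    obtain ⟨C, hCA, heC, hC⟩ := h e he
    have h1 := hC.two_le_degree hE (hCA.trans hA) ⟨e, heC, hv⟩
    have h2 := degree_edgeInduce_mono hE hA hCA v
    omega
  · rintro v ⟨e, he, hv⟩ ⟨-, hd⟩
    obtain ⟨C, hCA, heC, hC⟩ := h e he
    -- If the component of `v` in `A` were a cycle, degrees in the component of `v` in `C` would be
    -- at most two, hence equal to two, and that component would be a cycle as well.
    have hvC : v ∈ (G.edgeInduce C).vertexSet := ⟨e, heC, hv⟩
    refine hC.not_cycle v hvC ⟨component_isConnected hvC, fun w hw => ?_⟩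
    have hwA : w ∈ ((G.edgeInduce A).component v).vertexSet := by
      refine ⟨endSet_mono hCA hw.1, Relation.ReflTransGen.mono ?_ _ _ hw.2⟩
      rintro x y ⟨f, hf⟩
      exact ⟨f, edgeInduce_isLink.2 ⟨hCA (edgeInduce_isLink.1 hf).1, (edgeInduce_isLink.1 hf).2⟩⟩
    have h1 := hd w hwA
    rw [component_degree hwA] at h1
    rw [component_degree hw]
    have h2 := hC.two_le_degree hE (hCA.trans hA) hw.1
    have h3 := degree_edgeInduce_mono hE hA hCA w
    omega

/-- A non-empty union of circuits of `M_k(G)` spans a cacti-graph of excess at least `k`. -/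
lemma isCactiGraph_of_forall_exists_isCircuit (hA : A ⊆ G.edgeSet) (hne : A.Nonempty)
    (h : ∀ e ∈ A, ∃ C ⊆ A, (G.kCircularMatroid hE k hk).IsCircuit C ∧ e ∈ C) :
    (G.edgeInduce A).IsCactiGraph ∧ (G.endSet A).ncard + k ≤ A.ncard := by
  simp only [kCircularMatroid_isCircuit_iff] at h
  have hcact : (G.edgeInduce A).IsCactiGraph :=
    isCactiGraph_of_forall_exists_subset hE hA fun e he => by
      obtain ⟨C, hCA, hC, heC⟩ := h e he
      exact ⟨C, hCA, heC, hC.2.2⟩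
  refine ⟨hcact, ?_⟩
  obtain ⟨e, he⟩ := hne
  obtain ⟨C, hCA, hC, heC⟩ := h e he
  have h1 := ncard_of_mem_kCircuits hC
  obtain rfl | hss := hCA.eq_or_ssubset
  · exact h1.ge
  · have h2 := hcact.ncard_add_lt_of_ssubset hE hA hss
    omega

lemma edgeInduce_reflTransGen_mono (h : C ⊆ A) {x y : α}
    (hxy : Relation.ReflTransGen (G.edgeInduce C).Adj x y) :
    Relation.ReflTransGen (G.edgeInduce A).Adj x y := by
  refine Relation.ReflTransGen.mono ?_ _ _ hxy
  rintro x y ⟨f, hf⟩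
  exact ⟨f, edgeInduce_isLink.2 ⟨h (edgeInduce_isLink.1 hf).1, (edgeInduce_isLink.1 hf).2⟩⟩

/-- In a cacti-graph of excess at least `k`, connected if `k = 1`, any two edges lie on a common
circuit of `M_k(G)`. -/
lemma IsCactiGraph.exists_isCircuit_mem_mem (hcact : (G.edgeInduce A).IsCactiGraph)
    (hA : A ⊆ G.edgeSet) (hle : (G.endSet A).ncard + k ≤ A.ncard)
    (hconn : k = 1 → (G.edgeInduce A).IsConnected) (he : e ∈ A) (hf : f ∈ A) :
    ∃ C ⊆ A, (G.kCircularMatroid hE k hk).IsCircuit C ∧ e ∈ C ∧ f ∈ C := by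
  set M := G.kCircularMatroid hE k hk with hM
  have hAM : A ⊆ M.E := hA
  have hAf := hE.subset hA
  -- `B` is the matroid component of `e` in `M ↾ A`: every circuit inside `A` lies in `B` or in `A \
  -- B`.
  set B := {g ∈ A | ∃ C ⊆ A, M.IsCircuit C ∧ e ∈ C ∧ g ∈ C} with hB
  have hBA : B ⊆ A := Set.sep_subset ..
  have hclosed : ∀ C ⊆ A, M.IsCircuit C → (B ∩ C).Nonempty → C ⊆ B := by
    rintro C hCA hC ⟨g, ⟨hgA, C', hC'A, hC', heC', hgC'⟩, hgC⟩ h hh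
    have : (M ↾ A).Finite := ⟨hAf⟩
    obtain ⟨D, hD, heD, hhD⟩ := Matroid.exists_isCircuit_mem_mem_of_inter_nonempty (M := M ↾ A)
      ((Matroid.restrict_isCircuit_iff hAM).2 ⟨hC', hC'A⟩)
      ((Matroid.restrict_isCircuit_iff hAM).2 ⟨hC, hCA⟩) heC' hh ⟨g, hgC', hgC⟩
    rw [Matroid.restrict_isCircuit_iff hAM] at hD
    exact ⟨hCA hh, D, hD.2, hD.1, heD, hhD⟩
  by_contra hcon
  have hfB : f ∉ B := fun h => hcon h.2
  have heB : e ∈ B := by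
    obtain ⟨C, hCA, hC, heC⟩ := hcact.exists_isCircuit_mem (hk := hk) (hE := hE) hA hle he
    exact ⟨he, C, hCA, hC, heC, heC⟩
  have hDA : A \ B ⊆ A := Set.sdiff_subset
  obtain ⟨hBc, hBle⟩ := isCactiGraph_of_forall_exists_isCircuit (hk := hk) (hE := hE)
    (hBA.trans hA) ⟨e, heB⟩ fun g hg => by
      obtain ⟨C, hCA, hC, heC, hgC⟩ := hg.2
      exact ⟨C, hclosed C hCA hC ⟨g, hg, hgC⟩, hC, hgC⟩
  obtain ⟨hDc, hDle⟩ := isCactiGraph_of_forall_exists_isCircuit (hk := hk) (hE := hE)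
    (hDA.trans hA) ⟨f, hf, hfB⟩ fun g hg => by
      obtain ⟨C, hCA, hC, hgC⟩ := hcact.exists_isCircuit_mem (hk := hk) (hE := hE) hA hle hg.1
      exact ⟨C, fun h hh => ⟨hCA hh, fun hhB => hg.2 (hclosed C hCA hC ⟨h, hhB, hh⟩ hgC)⟩, hC, hgC⟩
  obtain ⟨I, hI⟩ := M.exists_isBasis B (hBA.trans hA)
  obtain ⟨J, hJ⟩ := M.exists_isBasis (A \ B) (hDA.trans hA)
  have hIc := hBc.ncard_of_isBasis (hBA.trans hA) hBle hI
  have hJc := hDc.ncard_of_isBasis (hDA.trans hA) hDle hJ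
  have hIJA : I ∪ J ⊆ A := Set.union_subset (hI.subset.trans hBA) (hJ.subset.trans hDA)
  have hind : M.Indep (I ∪ J) := by
    rw [Matroid.indep_iff_forall_subset_not_isCircuit (hIJA.trans hA)]
    intro C hC hCc
    by_cases hm : (B ∩ C).Nonempty
    · have hCB := hclosed C (hC.trans hIJA) hCc hm
      exact hCc.not_indep (hI.indep.subset fun g hg =>
        (hC hg).resolve_right fun hgJ => (hJ.subset hgJ).2 (hCB hg))
    · exact hCc.not_indep (hJ.indep.subset fun g hg =>
        (hC hg).resolve_left fun hgI => hm ⟨g, hI.subset hgI, hg⟩)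
  have h1 := ncard_add_one_le_of_indep hind
  have h2 := ncard_endSet_mono hE hA hIJA
  rw [Set.ncard_union_eq (Set.disjoint_left.2 fun g hg hg' => (hJ.subset hg').2 (hI.subset hg))
    (hAf.subset (hI.subset.trans hBA)) (hAf.subset (hJ.subset.trans hDA))] at h1
  have hVA : G.endSet A = G.endSet B ∪ G.endSet (A \ B) := by
    rw [← endSet_union, Set.union_sdiff_cancel hBA]
  have h3 := Set.ncard_union_add_ncard_inter (G.endSet B) (G.endSet (A \ B))
    (endSet_finite (hAf.subset hBA)) (endSet_finite (hAf.subset hDA))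
  rw [← hVA] at h3
  -- The bases `I` and `J` have `|V(B)| + k - 1` and `|V(A \ B)| + k - 1` elements, and their
  -- independent union has at most `|V(A)| + k - 1`. So the number of common vertices plus `k` is at
  -- most `1`.
  have hk1 : k = 1 := by omega
  have hdisj : G.endSet B ∩ G.endSet (A \ B) = ∅ := by
    rw [← Set.ncard_eq_zero ((endSet_finite (hAf.subset hBA)).subset Set.inter_subset_left)]
    omega
  obtain ⟨x, y, hxy⟩ := exists_isLink_of_mem_edgeSet (hA he)
  obtain ⟨u, v, huv⟩ := exists_isLink_of_mem_edgeSet (hA hf)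
  have huD : u ∈ G.endSet (A \ B) := ⟨f, ⟨hf, hfB⟩, huv.inc_left⟩
  have hreach : ∀ w, Relation.ReflTransGen (G.edgeInduce A).Adj x w → w ∈ G.endSet B := by
    intro w hw
    induction hw with
    | refl => exact ⟨e, heB, hxy.inc_left⟩
    | @tail b c _ h ih =>
      obtain ⟨g, hg⟩ := h
      obtain ⟨hgA, hg⟩ := edgeInduce_isLink.1 hg
      by_cases hgB : g ∈ B
      · exact ⟨g, hgB, hg.inc_right⟩
      · have : b ∈ G.endSet B ∩ G.endSet (A \ B) := ⟨ih, g, ⟨hgA, hgB⟩, hg.inc_left⟩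
        simp [hdisj] at this
  have hu : u ∈ G.endSet B ∩ G.endSet (A \ B) :=
    ⟨hreach u ((hconn hk1).2 x ⟨e, he, hxy.inc_left⟩ u ⟨f, hf, huv.inc_left⟩), huD⟩
  simp [hdisj] at hu

/-- The circuits of the bicircular matroid `M_1(G)` span connected subgraphs. -/
lemma isConnected_of_mem_kCircuits_one (hE : G.edgeSet.Finite) (hC : C ∈ G.kCircuits 1) :
    (G.edgeInduce C).IsConnected := by
  have hCf := hE.subset hC.1
  have hVf := G.endSet_finite hCf
  have hcard := ncard_of_mem_kCircuits hC
  refine ⟨?_, fun x hx y hy => ?_⟩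
  · obtain ⟨e, he⟩ : C.Nonempty := by
      rw [← Set.ncard_pos hCf]
      omega
    obtain ⟨x, y, hxy⟩ := exists_isLink_of_mem_edgeSet (hC.1 he)
    exact ⟨x, e, he, hxy.inc_left⟩
  by_contra hcon
  set R := {w | Relation.ReflTransGen (G.edgeInduce C).Adj x w} with hR
  set F := {e ∈ C | ∃ w ∈ R, G.Inc e w} with hF
  have hFC : F ⊆ C := Set.sep_subset ..
  have hFR : G.endSet F ⊆ R := by
    rintro v ⟨e, ⟨heC, w, hw, hew⟩, hev⟩
    obtain ⟨u, hu⟩ := hew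
    rcases hev.eq_or_eq_of_isLink hu with rfl | rfl
    · exact hw
    · exact hw.tail ⟨e, edgeInduce_isLink.2 ⟨heC, hu⟩⟩
  have hFR' : Disjoint (G.endSet F) (G.endSet (C \ F)) := by
    refine Set.disjoint_left.2 fun v hv => ?_
    rintro ⟨e, ⟨heC, heF⟩, hev⟩
    exact heF ⟨heC, v, hFR hv, hev⟩
  have h1 : F ⊂ C := by
    refine ⟨hFC, fun h => ?_⟩
    obtain ⟨e, heC, hey⟩ := hy
    exact hcon (hFR ⟨e, h heC, hey⟩)
  have h2 : C \ F ⊂ C := by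
    refine ⟨Set.sdiff_subset, fun h => ?_⟩
    obtain ⟨e, heC, hex⟩ := hx
    exact (h heC).2 ⟨heC, x, Relation.ReflTransGen.refl, hex⟩
  have h3 := sparse_of_ssubset_kCircuit hE hC h1
  -- Both pieces have excess at most `0` and share no vertex, so `C` could not have excess `1`.
  have h4 := sparse_of_ssubset_kCircuit hE hC h2
  have h5 := Set.ncard_sdiff_add_ncard_of_subset hFC hCf
  have h6 := Set.ncard_union_eq hFR' (endSet_finite (hCf.subset hFC))
    (endSet_finite (hCf.subset Set.sdiff_subset))
  rw [← endSet_union, Set.union_sdiff_cancel hFC] at h6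
  omega

/-- Even a loop of the graph has excess `0`, which is less than `k`. -/
lemma kCircularMatroid_not_isLoop : ¬ (G.kCircularMatroid hE k hk).IsLoop e := by
  rw [← Matroid.singleton_isCircuit, kCircularMatroid_isCircuit_iff]
  intro h
  have h1 := ncard_of_mem_kCircuits h
  obtain ⟨x, y, hxy⟩ := exists_isLink_of_mem_edgeSet (h.1 rfl)
  have h2 : 0 < (G.endSet {e}).ncard :=
    (Set.ncard_pos (endSet_finite (Set.finite_singleton e))).2 ⟨x, e, rfl, hxy.inc_left⟩
  rw [Set.ncard_singleton] at h1
  omega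

/-- Characterization of the connected restrictions of `M_k(G)`. -/
lemma kCircularMatroid_delete_isConnected_iff :
    ((G.kCircularMatroid hE k hk) ＼ K).IsConnected ↔
      (G.edgeInduce (G.edgeSet \ K)).IsCactiGraph ∧
      (G.endSet (G.edgeSet \ K)).ncard + k ≤ (G.edgeSet \ K).ncard ∧
      (k = 1 → (G.edgeInduce (G.edgeSet \ K)).IsConnected) := by
  have hA : G.edgeSet \ K ⊆ G.edgeSet := Set.sdiff_subset
  have hcirc : ∀ C, ((G.kCircularMatroid hE k hk) ＼ K).IsCircuit C ↔
      C ⊆ G.edgeSet \ K ∧ (G.kCircularMatroid hE k hk).IsCircuit C := by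
    intro C
    rw [Matroid.delete_isCircuit_iff, Set.subset_sdiff]
    exact ⟨fun h => ⟨⟨h.1.subset_ground, h.2⟩, h.1⟩, fun h => ⟨h.2, h.1.2⟩⟩
  constructor
  · intro h
    have hmem : ∀ e ∈ G.edgeSet \ K, ∃ C ⊆ G.edgeSet \ K,
        (G.kCircularMatroid hE k hk).IsCircuit C ∧ e ∈ C := by
      intro e he
      obtain ⟨C, hC, heC⟩ := Matroid.exists_mem_isCircuit_of_not_isColoop
        (M := (G.kCircularMatroid hE k hk) ＼ K) he (h.not_isColoop e)
      exact ⟨C, ((hcirc C).1 hC).1, ((hcirc C).1 hC).2, heC⟩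
    obtain ⟨h1, h2⟩ := isCactiGraph_of_forall_exists_isCircuit hA h.nonempty hmem
    refine ⟨h1, h2, ?_⟩
    rintro rfl
    refine ⟨?_, ?_⟩
    · obtain ⟨e, he⟩ := h.nonempty
      obtain ⟨x, y, hxy⟩ := exists_isLink_of_mem_edgeSet (hA he)
      exact ⟨x, e, he, hxy.inc_left⟩
    · rintro x ⟨e, he, hx⟩ y ⟨f, hf, hy⟩
      obtain ⟨C, hCA, hC, heC, hfC⟩ : ∃ C ⊆ G.edgeSet \ K,
          (G.kCircularMatroid hE 1 hk).IsCircuit C ∧ e ∈ C ∧ f ∈ C := by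
        obtain rfl | hne := eq_or_ne e f
        · obtain ⟨C, hCA, hC, heC⟩ := hmem e he
          exact ⟨C, hCA, hC, heC, heC⟩
        · obtain ⟨C, hC, heC, hfC⟩ := h.exists_isCircuit e he f hf hne
          exact ⟨C, ((hcirc C).1 hC).1, ((hcirc C).1 hC).2, heC, hfC⟩
      rw [kCircularMatroid_isCircuit_iff] at hC
      exact edgeInduce_reflTransGen_mono hCA
        ((isConnected_of_mem_kCircuits_one hE hC).2 x ⟨e, heC, hx⟩ y ⟨f, hfC, hy⟩)
  · rintro ⟨h1, h2, h3⟩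
    refine ⟨?_, fun e he => ?_, fun e he => ?_, fun e he f hf _ => ?_⟩
    · change (G.edgeSet \ K).Nonempty
      rw [← Set.ncard_pos (hE.subset hA)]
      omega
    · exact kCircularMatroid_not_isLoop ((Matroid.delete_isLoop_iff.1 he).1)
    · obtain ⟨C, hCA, hC, heC⟩ := h1.exists_isCircuit_mem (hk := hk) (hE := hE) hA h2
        he.mem_ground
      exact he.notMem_isCircuit ((hcirc C).2 ⟨hCA, hC⟩) heC
    · obtain ⟨C, hCA, hC, heC⟩ :=
        h1.exists_isCircuit_mem_mem (hk := hk) (hE := hE) hA h2 h3 he hf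
      exact ⟨C, (hcirc C).2 ⟨hCA, hC⟩, heC⟩

/-! ### Vertex deletion, spanning sets and cocircuits. -/

lemma endSet_edgeSet (hG : ∀ v, ¬ G.IsIsolated v) : G.endSet G.edgeSet = G.vertexSet := by
  refine Set.Subset.antisymm ?_ fun v hv => ?_
  · rintro v ⟨e, -, hv⟩
    exact hv.vertex_mem
  · obtain ⟨e, he⟩ := Set.nonempty_iff_ne_empty.2 fun h => hG v ⟨hv, h⟩
    exact ⟨e, he.edge_mem, he⟩

lemma endSet_sdiff_incidenceSet_subset (x : α) :
    G.endSet (G.edgeSet \ G.incidenceSet x) ⊆ G.vertexSet \ {x} := by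
  rintro v ⟨e, ⟨-, hex⟩, hev⟩
  refine ⟨hev.vertex_mem, ?_⟩
  rintro rfl
  exact hex hev

/-- Deleting `x` may leave isolated vertices, which an edge-induced subgraph drops; the hypothesis
rules this out. -/
lemma edgeInduce_eq_deleteVerts {x : α}
    (h : G.vertexSet \ {x} ⊆ G.endSet (G.edgeSet \ G.incidenceSet x)) :
    G.edgeInduce (G.edgeSet \ G.incidenceSet x) = G.deleteVerts {x} := by
  refine Graph.ext ?_ fun e u v => ?_
  · rw [vertexSet_edgeInduce, vertexSet_deleteVerts]
    exact (endSet_sdiff_incidenceSet_subset x).antisymm h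
  · rw [edgeInduce_isLink, deleteVerts_isLink]
    constructor
    · rintro ⟨⟨-, hx⟩, hl⟩
      refine ⟨hl, ?_, ?_⟩
      · rintro rfl
        exact hx hl.inc_left
      · rintro rfl
        exact hx hl.inc_right
    · rintro ⟨hl, hu, hv⟩
      refine ⟨⟨hl.edge_mem, fun hx => ?_⟩, hl⟩
      rcases Inc.eq_or_eq_of_isLink hx hl with rfl | rfl
      · exact hu rfl
      · exact hv rfl

lemma subset_endSet_of_deleteVerts_not_isIsolated {x : α}
    (h : ∀ v, ¬ (G.deleteVerts {x}).IsIsolated v) :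
    G.vertexSet \ {x} ⊆ G.endSet (G.edgeSet \ G.incidenceSet x) := by
  intro v hv
  rw [← vertexSet_deleteVerts] at hv
  obtain ⟨e, u, he⟩ := Set.nonempty_iff_ne_empty.2 fun hemp => h v ⟨hv, hemp⟩
  rw [deleteVerts_isLink] at he
  refine ⟨e, ⟨he.1.edge_mem, fun hx => ?_⟩, he.1.inc_left⟩
  rcases Inc.eq_or_eq_of_isLink hx he.1 with rfl | rfl
  · exact he.2.1 rfl
  · exact he.2.2 rfl

/-- Connectedness of `M = M ＼ ∅` makes `G` itself a cacti-graph of excess at least `k`, so the rank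
formula applies to it. -/
lemma kCircularMatroid_ncard_of_isBase (hG : ∀ v, ¬ G.IsIsolated v)
    (hM : (G.kCircularMatroid hE k hk).IsConnected) (hB : (G.kCircularMatroid hE k hk).IsBase B) :
    B.ncard + 1 = G.vertexSet.ncard + k := by
  rw [← Matroid.delete_empty (G.kCircularMatroid hE k hk),
    kCircularMatroid_delete_isConnected_iff, Set.sdiff_empty] at hM
  rw [← endSet_edgeSet hG]
  exact hM.1.ncard_of_isBasis subset_rfl hM.2.1 hB.isBasis_ground

lemma kCircularMatroid_spanning_iff (hG : ∀ v, ¬ G.IsIsolated v)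
    (hM : (G.kCircularMatroid hE k hk).IsConnected)
    (hI : (G.kCircularMatroid hE k hk).IsBasis I X) :
    (G.kCircularMatroid hE k hk).Spanning X ↔ G.vertexSet.ncard + k ≤ I.ncard + 1 := by
  obtain ⟨B, hB⟩ := (G.kCircularMatroid hE k hk).exists_isBase
  have h := kCircularMatroid_ncard_of_isBase hG hM hB
  rw [Matroid.spanning_iff_eRk_le hI.subset_ground, ← hB.encard_eq_eRank, ← hI.encard_eq_eRk,
    ← (hE.subset hB.subset_ground).cast_ncard_eq,
    ← (hE.subset (hI.subset.trans hI.subset_ground)).cast_ncard_eq, Nat.cast_le]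
  omega

lemma kCircularMatroid_not_spanning (hG : ∀ v, ¬ G.IsIsolated v)
    (hM : (G.kCircularMatroid hE k hk).IsConnected) (hX : X ⊆ G.edgeSet)
    (hlt : (G.endSet X).ncard < G.vertexSet.ncard) :
    ¬ (G.kCircularMatroid hE k hk).Spanning X := by
  obtain ⟨I, hI⟩ := (G.kCircularMatroid hE k hk).exists_isBasis X hX
  rw [kCircularMatroid_spanning_iff hG hM hI]
  have h1 := ncard_add_one_le_of_indep hI.indep
  have h2 := ncard_endSet_mono hE hX hI.subset
  omega

/-- The corank is `|E|` minus the rank `|V| + k - 1`. For `X = S(x)`, with `G \ x` having one vertex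
fewer, the right side says that `G \ x` has excess at least `k`. -/
lemma encard_le_dual_eRank_iff (hG : ∀ v, ¬ G.IsIsolated v)
    (hM : (G.kCircularMatroid hE k hk).IsConnected) (hX : X ⊆ G.edgeSet) :
    X.encard ≤ (G.kCircularMatroid hE k hk)✶.eRank ↔
      G.vertexSet.ncard + k ≤ (G.edgeSet \ X).ncard + 1 := by
  obtain ⟨B, hB⟩ := (G.kCircularMatroid hE k hk).exists_isBase
  have h := kCircularMatroid_ncard_of_isBase hG hM hB
  rw [← hB.encard_compl_eq, kCircularMatroid_ground, ← (hE.subset hX).cast_ncard_eq,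
    ← (hE.subset Set.sdiff_subset).cast_ncard_eq, Nat.cast_le]
  have h1 := Set.ncard_sdiff_add_ncard_of_subset hX hE
  have h2 := Set.ncard_sdiff_add_ncard_of_subset hB.subset_ground hE
  rw [kCircularMatroid_ground] at h2
  omega

/-- If the edges that avoid `x` span a cacti-graph of excess at least `k` on all the other
vertices, then the edges at `x` form a cocircuit of `M_k(G)`. -/
lemma isCocircuit_incidenceSet (hG : ∀ v, ¬ G.IsIsolated v) (hV : G.vertexSet.Finite)
    (hM : (G.kCircularMatroid hE k hk).IsConnected) {x : α} (hx : x ∈ G.vertexSet)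
    (hcact : (G.edgeInduce (G.edgeSet \ G.incidenceSet x)).IsCactiGraph)
    (hend : G.endSet (G.edgeSet \ G.incidenceSet x) = G.vertexSet \ {x})
    (hle : (G.endSet (G.edgeSet \ G.incidenceSet x)).ncard + k ≤
      (G.edgeSet \ G.incidenceSet x).ncard) :
    (G.kCircularMatroid hE k hk).IsCocircuit (G.incidenceSet x) := by
  have hcard := Set.ncard_sdiff_singleton_add_one hx hV
  rw [Matroid.isCocircuit_iff_minimal_compl_nonspanning, Set.minimal_iff_forall_ssubset]
  refine ⟨kCircularMatroid_not_spanning hG hM Set.sdiff_subset ?_, fun Y hY => not_not.2 ?_⟩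
  · rw [kCircularMatroid_ground, hend]
    omega
  obtain ⟨e, hex, heY⟩ := Set.exists_of_ssubset hY
  obtain ⟨I, hI⟩ := (G.kCircularMatroid hE k hk).exists_isBasis (G.edgeSet \ G.incidenceSet x)
    Set.sdiff_subset
  have hIc := hcact.ncard_of_isBasis Set.sdiff_subset hle hI
  have heI : e ∉ I := fun h => (hI.subset h).2 hex
  have hIE : I ⊆ G.edgeSet := hI.indep.subset_ground
  have hins : insert e I ⊆ G.edgeSet := Set.insert_subset hex.edge_mem hIE
  -- No edge of `I` touches `x`, so any subset containing `e` gains the vertex `x` along with the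
  -- edge `e`, and the counting bound survives.
  have hind : (G.kCircularMatroid hE k hk).Indep (insert e I) := by
    refine kCircularMatroid_indep_iff_ncard.2 ⟨hins, fun Z hZ => ?_⟩
    have hZf := (hE.subset hins).subset hZ
    have hZI : Z \ {e} ⊆ I := fun g hg => (hZ hg.1).resolve_left hg.2
    have h1 := ncard_add_one_le_of_indep (hI.indep.subset hZI)
    by_cases heZ : e ∈ Z
    · have h2 := Set.ncard_sdiff_singleton_add_one heZ hZf
      have h3 : (G.endSet (Z \ {e})).ncard < (G.endSet Z).ncard := by
        refine Set.ncard_lt_ncard ⟨endSet_mono Set.sdiff_subset, fun h => ?_⟩ (endSet_finite hZf)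
        obtain ⟨g, hg, hgx⟩ := h ⟨e, heZ, hex⟩
        exact (hI.subset (hZI hg)).2 hgx
      omega
    · rwa [Set.sdiff_singleton_eq_self heZ] at h1
  have hsub : insert e I ⊆ G.edgeSet \ Y :=
    Set.insert_subset ⟨hex.edge_mem, heY⟩ fun g hg =>
      ⟨hIE hg, fun hgY => (hI.subset hg).2 (hY.subset hgY)⟩
  refine Matroid.Spanning.superset (S := insert e I) ?_ hsub Set.sdiff_subset
  rw [kCircularMatroid_spanning_iff hG hM hind.isBasis_self,
    Set.ncard_insert_of_notMem heI (hE.subset hIE)]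
  rw [hend] at hIc
  omega

/-- A non-separating cocircuit of a connected `M_k(G)` consists of the edges at a vertex. -/
lemma exists_eq_incidenceSet_of_isNonseparatingCocircuit (hV : G.vertexSet.Finite)
    (hG : ∀ v, ¬ G.IsIsolated v) (hM : (G.kCircularMatroid hE k hk).IsConnected)
    (h : (G.kCircularMatroid hE k hk).IsNonseparatingCocircuit K) :
    ∃ x ∈ G.vertexSet, K = G.incidenceSet x ∧
      (G.incidenceSet x).encard ≤ (G.kCircularMatroid hE k hk)✶.eRank ∧
      (k = 1 → (G.deleteVerts {x}).IsCactus) ∧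
      (2 ≤ k → (G.deleteVerts {x}).IsCactiGraph) := by
  obtain ⟨hK, hdel⟩ := h
  obtain ⟨hcact, hle, hconn⟩ := kCircularMatroid_delete_isConnected_iff.1 hdel
  have hA : G.edgeSet \ K ⊆ G.edgeSet := Set.sdiff_subset
  have hKE : K ⊆ G.edgeSet := hK.subset_ground
  have hKne := hK.nonempty
  rw [Matroid.isCocircuit_iff_minimal_compl_nonspanning] at hK
  obtain ⟨I, hI⟩ := (G.kCircularMatroid hE k hk).exists_isBasis (G.edgeSet \ K) hA
  have hIc := hcact.ncard_of_isBasis hA hle hI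
  have hns := hK.prop
  rw [kCircularMatroid_ground, kCircularMatroid_spanning_iff hG hM hI] at hns
  have hsubV : G.endSet (G.edgeSet \ K) ⊆ G.vertexSet :=
    (endSet_mono hA).trans (endSet_edgeSet hG).subset
  -- `E \ K` has rank `|V(E \ K)| + k - 1`, which falls short of `|V| + k - 1`.
  obtain ⟨x, hx, hxA⟩ : ∃ x ∈ G.vertexSet, x ∉ G.endSet (G.edgeSet \ K) := by
    by_contra! h
    have := Set.ncard_le_ncard (s := G.vertexSet) h (hV.subset hsubV)
    omega
  have hcard := Set.ncard_sdiff_singleton_add_one hx hV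
  have hxK : G.incidenceSet x ⊆ K := fun e he => by
    by_contra heK
    exact hxA ⟨e, ⟨he.edge_mem, heK⟩, he⟩
  have hxns : ¬ (G.kCircularMatroid hE k hk).Spanning
      ((G.kCircularMatroid hE k hk).E \ G.incidenceSet x) := by
    refine kCircularMatroid_not_spanning hG hM Set.sdiff_subset ?_
    have := Set.ncard_le_ncard (endSet_sdiff_incidenceSet_subset (G := G) x)
      (hV.subset Set.sdiff_subset)
    rw [kCircularMatroid_ground]
    omega
  obtain rfl : K = G.incidenceSet x := (hK.eq_of_subset hxns hxK).symm
  -- Restoring a single edge `e` of the cocircuit makes the complement spanning, so `E \ S(x)` has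
  -- rank at least `|V| + k - 2` and thus at least `|V| - 1` ends: only `x` is missed.
  have hend : G.vertexSet \ {x} ⊆ G.endSet (G.edgeSet \ G.incidenceSet x) := by
    obtain ⟨e, he⟩ := hKne
    have heA : e ∉ G.edgeSet \ G.incidenceSet x := fun h => h.2 he
    have hsp : (G.kCircularMatroid hE k hk).Spanning
        (G.edgeSet \ (G.incidenceSet x \ {e})) := by
      by_contra h
      exact ((hK.eq_of_subset h Set.sdiff_subset).ge he).2 rfl
    have hins : G.edgeSet \ (G.incidenceSet x \ {e}) =
        insert e (G.edgeSet \ G.incidenceSet x) := by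
      ext g
      have := hKE he
      simp only [Set.mem_sdiff, Set.mem_singleton_iff, Set.mem_insert_iff]
      grind
    rw [hins] at hsp
    obtain ⟨J, hJ⟩ := (G.kCircularMatroid hE k hk).exists_isBasis _ hsp.subset_ground
    rw [kCircularMatroid_spanning_iff hG hM hJ] at hsp
    have hJE : J.Finite := hE.subset hJ.indep.subset_ground
    have hJA : J \ {e} ⊆ G.edgeSet \ G.incidenceSet x :=
      fun g hg => (hJ.subset hg.1).resolve_left hg.2
    have h1 := ncard_add_one_le_of_indep (hJ.indep.subset (Set.sdiff_subset (t := {e})))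
    have h2 := ncard_endSet_mono hE hA hJA
    have h3 := Set.ncard_le_ncard_sdiff_add_ncard J {e}
    rw [Set.ncard_singleton] at h3
    exact (Set.eq_of_subset_of_ncard_le (endSet_sdiff_incidenceSet_subset x) (by omega)
      (hV.subset Set.sdiff_subset)).ge
  have heq := edgeInduce_eq_deleteVerts hend
  refine ⟨x, hx, rfl, ?_, fun h1 => ?_, fun _ => heq ▸ hcact⟩
  · rw [encard_le_dual_eRank_iff hG hM hKE]
    have := Set.ncard_le_ncard hend (hV.subset hsubV)
    omega
  · rw [← heq]
    exact ⟨hcact, hconn h1⟩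

lemma isNonseparatingCocircuit_incidenceSet (hV : G.vertexSet.Finite)
    (hG : ∀ v, ¬ G.IsIsolated v) (hM : (G.kCircularMatroid hE k hk).IsConnected) {x : α}
    (hx : x ∈ G.vertexSet)
    (hrank : (G.incidenceSet x).encard ≤ (G.kCircularMatroid hE k hk)✶.eRank)
    (hone : k = 1 → (G.deleteVerts {x}).IsCactus)
    (htwo : 2 ≤ k → (G.deleteVerts {x}).IsCactiGraph) :
    (G.kCircularMatroid hE k hk).IsNonseparatingCocircuit (G.incidenceSet x) := by
  have hcactx : (G.deleteVerts {x}).IsCactiGraph := by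
    obtain h | h := hk.eq_or_lt
    · exact (hone h.symm).1
    · exact htwo h
  have hend := subset_endSet_of_deleteVerts_not_isIsolated hcactx.not_isolated
  have heq := edgeInduce_eq_deleteVerts hend
  have hend' := hend.antisymm (endSet_sdiff_incidenceSet_subset x)
  have hcard := Set.ncard_sdiff_singleton_add_one hx hV
  rw [encard_le_dual_eRank_iff hG hM (G.incidenceSet_subset_edgeSet x)] at hrank
  rw [← heq] at hcactx hone
  have hle : (G.endSet (G.edgeSet \ G.incidenceSet x)).ncard + k ≤
      (G.edgeSet \ G.incidenceSet x).ncard := by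
    rw [← hend']
    omega
  exact ⟨isCocircuit_incidenceSet hG hV hM hx hcactx hend'.symm hle,
    kCircularMatroid_delete_isConnected_iff.2 ⟨hcactx, hle, fun h => (hone h).2⟩⟩

end Graph

theorem mainTheorem5 {α β : Type*} (G : Graph α β)
    (hV : G.vertexSet.Finite) (hE : G.edgeSet.Finite) (hG : ∀ v, ¬ G.IsIsolated v)
    (k : ℕ) (hk : 1 ≤ k) (hM : (G.kCircularMatroid hE k hk).IsConnected) (K : Set β) :
    (G.kCircularMatroid hE k hk).IsNonseparatingCocircuit K ↔
      ∃ x ∈ G.vertexSet, K = G.incidenceSet x ∧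
        (G.incidenceSet x).encard ≤ (G.kCircularMatroid hE k hk)✶.eRank ∧
        (k = 1 → (G.deleteVerts {x}).IsCactus) ∧
        (2 ≤ k → (G.deleteVerts {x}).IsCactiGraph) := by
  constructor
  · exact Graph.exists_eq_incidenceSet_of_isNonseparatingCocircuit hV hG hM
  · rintro ⟨x, hx, rfl, hrank, hone, htwo⟩
    exact Graph.isNonseparatingCocircuit_incidenceSet hV hG hM hx hrank hone htwo
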